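/- For an integer $N\ge 1$, let $r(N)$ be the number of isomorphism classes of commutative rings (associative, with $1$) of order at most $N$. Then, as $N\to\infty$, $$r(N)=\exp\left(\frac{2}{27}\,\frac{(\log N)^3}{(\log 2)^2}+O\big((\log N)^{8/3}\big)\right).$$ That is, there is a function $E$ with $r(N)=\exp\left(\frac{2}{27}(\log N)^3/(\log 2)^2+E(N)\right)$ for all integers $N\ge 1$ and $E(N)=O\big((\log N)^{8/3}\big)$ as $N\to\infty$. -/

import Mathlib

/-- Two commutative rings with `1`, both finite of order at most `N`, are identified when there is
a ring isomorphism between them. -/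
def finCommRingSetoid (N : ℕ) :
    Setoid {R : CommRingCat.{0} // Finite R ∧ Nat.card R ≤ N} where
  r R S := Nonempty (R.1 ≃+* S.1)
  iseqv :=
    { refl := fun R => ⟨RingEquiv.refl R.1⟩
      symm := fun ⟨e⟩ => ⟨e.symm⟩
      trans := fun ⟨e⟩ ⟨f⟩ => ⟨e.trans f⟩ }

/-- The number of isomorphism classes of (unital) commutative rings of order at most `N`. The zero
ring, of order `1`, is included. Every finite ring is isomorphic to one whose carrier lies in
`Type`, so no isomorphism class is lost by working in the lowest universe. -/
noncomputable def numCommRings (N : ℕ) : ℕ :=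
  Nat.card (Quotient (finCommRingSetoid N))

/-! Write L = log N and let n be about log N / log 2. Both bounds rest on rings whose nilradical J
has J/J² of rank about 2n/3 and J² of order about 2^(n/3): the products of generators of J/J² form a
symmetric table with entries in J².

Upper bound. With x₁, …, x_r lifting generators of J/J², the symmetric table takes at most
|J²|^(r(r+1)/2) values, where |J²|·2^r ≤ N. Maximizing y²(L - y) at y = r log 2 gives the main term.
The rest of the multiplication must be cheap to record. It suffices to know how a small set W
multiplies, provided that J² = (W)J and that W generates R modulo J as a ring: by nilpotency of J,
the elements 1 and xᵢ then yield all of R additively under multiplication by W. Each element of W is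
recorded as an additive endomorphism, at logarithmic cost nL. A greedy choice and a lemma on
symmetric bilinear maps with small ranges (`exists_card_le_sq_add_one_forall_mem_iSup_range`) give
|W| of order n/h + h² + log n; taking h of order n^(1/3) gives the error L^(8/3).
`map_mul_of_generators` shows that the recorded data determine the ring.

Lower bound. Symmetric tables over 𝔽₂ define rings 𝔽₂ ⊕ V ⊕ U, and an isomorphism class accounts for
at most |End(A)| tables, A being the additive group. The logarithm of this loss is only quadratic in
L. -/

/-! ### Generators, homomorphisms and subgroups of finite abelian groups -/

theorem AddSubgroup.natCard_le {A : Type*} [AddCommGroup A] [Finite A] (H : AddSubgroup A) :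
    Nat.card H ≤ Nat.card A :=
  Nat.card_le_card_of_injective _ Subtype.val_injective

theorem AddSubgroup.closure_range_coe {A ι : Type*} [AddCommGroup A] {K : AddSubgroup A}
    {g : ι → K} (hg : AddSubgroup.closure (Set.range g) = ⊤) :
    AddSubgroup.closure (Set.range fun i => (g i : A)) = K := by
  have := congrArg (AddSubgroup.map K.subtype) hg
  rw [AddMonoidHom.map_closure, ← Set.range_comp, ← AddMonoidHom.range_eq_map,
    AddSubgroup.range_subtype] at this
  exact this

theorem AddSubgroup.two_mul_card_le_of_lt {A : Type*} [AddCommGroup A] [Finite A]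
    {H K : AddSubgroup A} (h : H < K) : 2 * Nat.card H ≤ Nat.card K := by
  obtain ⟨c, hc⟩ := AddSubgroup.card_dvd_of_le h.le
  have hK : 0 < Nat.card K := Nat.card_pos
  have hne : Nat.card H ≠ Nat.card K := fun e =>
    h.ne (AddSubgroup.eq_of_le_of_card_ge h.le e.ge)
  have : c ≠ 0 := by rintro rfl; omega
  have : c ≠ 1 := by rintro rfl; omega
  have : 2 ≤ c := by omega
  nlinarith

/-- Each element outside the subgroup generated so far at least doubles its order, so a largest `T`
with `2 ^ T.card` at most the order of its closure must generate. -/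
theorem exists_finset_closure_eq_top (A : Type*) [AddCommGroup A] [Finite A] :
    ∃ T : Finset A, AddSubgroup.closure (T : Set A) = ⊤ ∧ 2 ^ T.card ≤ Nat.card A := by
  classical
  have := Fintype.ofFinite A
  obtain ⟨T, hT, hmax⟩ := Finset.exists_max_image
    (Finset.univ.filter fun T : Finset A =>
      2 ^ T.card ≤ Nat.card (AddSubgroup.closure (T : Set A))) Finset.card
    ⟨∅, by simp⟩
  simp only [Finset.mem_filter, Finset.mem_univ, true_and] at hT hmax
  refine ⟨T, ?_, hT.trans (AddSubgroup.natCard_le _)⟩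
  by_contra hne
  obtain ⟨a, ha⟩ : ∃ a, a ∉ AddSubgroup.closure (T : Set A) := by
    by_contra! h
    exact hne (eq_top_iff.2 fun a _ => h a)
  have haT : a ∉ T := fun h => ha (AddSubgroup.subset_closure h)
  have hlt : AddSubgroup.closure (T : Set A) <
      AddSubgroup.closure ((insert a T : Finset A) : Set A) := by
    refine lt_of_le_of_ne (AddSubgroup.closure_mono (by simp)) fun e => ha ?_
    rw [e]
    exact AddSubgroup.subset_closure (by simp)
  have h1 := AddSubgroup.two_mul_card_le_of_lt hlt
  have h2 := hmax (insert a T) (by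
    rw [Finset.card_insert_of_notMem haT, pow_succ]
    omega)
  rw [Finset.card_insert_of_notMem haT] at h2
  omega

theorem exists_fin_closure_range_eq_top (A : Type*) [AddCommGroup A] [Finite A] :
    ∃ (k : ℕ) (g : Fin k → A), AddSubgroup.closure (Set.range g) = ⊤ ∧ 2 ^ k ≤ Nat.card A := by
  obtain ⟨T, hT, hc⟩ := exists_finset_closure_eq_top A
  refine ⟨T.card, fun i => T.equivFin.symm i, ?_, hc⟩
  rw [← hT]
  congr 1
  ext a
  constructor
  · rintro ⟨i, rfl⟩
    exact (T.equivFin.symm i).2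
  · intro ha
    exact ⟨T.equivFin ⟨a, ha⟩, by simp⟩

theorem exists_fin_closure_range_eq_top_of_lt {A : Type*} [AddCommGroup A] [Finite A] {n : ℕ}
    (hn : Nat.card A < 2 ^ (n + 1)) :
    ∃ g : Fin n → A, AddSubgroup.closure (Set.range g) = ⊤ := by
  obtain ⟨k, g, hg, hk⟩ := exists_fin_closure_range_eq_top A
  have hkn : k ≤ n := by
    have := (Nat.pow_lt_pow_iff_right (by norm_num : 1 < 2)).1 (hk.trans_lt hn)
    omega
  refine ⟨fun i => if h : i.1 < k then g ⟨i, h⟩ else 0, ?_⟩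
  rw [eq_top_iff, ← hg]
  refine AddSubgroup.closure_mono ?_
  rintro _ ⟨i, rfl⟩
  exact ⟨⟨i, i.2.trans_le hkn⟩, by simp⟩

theorem card_addMonoidHom_le {A B : Type*} [AddCommGroup A] [Finite A] [AddCommGroup B] [Finite B]
    {n : ℕ} (hn : Nat.card A < 2 ^ (n + 1)) : Nat.card (A →+ B) ≤ Nat.card B ^ n := by
  obtain ⟨g, hg⟩ := exists_fin_closure_range_eq_top_of_lt hn
  have hinj : Function.Injective fun (f : A →+ B) (i : Fin n) => f (g i) := by
    intro f f' hff
    refine AddMonoidHom.eq_of_eqOn_dense hg ?_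
    rintro _ ⟨i, rfl⟩
    exact congrFun hff i
  simpa [Nat.card_fun] using Nat.card_le_card_of_injective _ hinj

theorem card_addSubgroup_le {A : Type*} [AddCommGroup A] [Finite A]
    {n : ℕ} (hn : Nat.card A < 2 ^ (n + 1)) : Nat.card (AddSubgroup A) ≤ Nat.card A ^ n := by
  have hsurj : Function.Surjective fun g : Fin n → A => AddSubgroup.closure (Set.range g) := by
    intro K
    obtain ⟨g, hg⟩ := exists_fin_closure_range_eq_top_of_lt (A := K) (n := n)
      ((AddSubgroup.natCard_le K).trans_lt hn)
    refine ⟨fun i => (g i : A), ?_⟩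
    exact AddSubgroup.closure_range_coe hg
  simpa [Nat.card_fun] using Nat.card_le_card_of_surjective _ hsurj

/-! ### Few multipliers suffice: bilinear maps and generators of finite rings -/

/-- Take `w` with the largest range, generated by the values `β w (c i)` for `h` elements `c i`. If
`k` is orthogonal to every `c i`, then `β (w + k)` agrees with `β w` on them, so its range contains
that of `β w` and equals it by maximality; hence `β k` has range inside that of `β w`. Such `k` form
a subgroup of index at most `2 ^ (h ^ 2)`, and lifting generators of the quotient costs at most `h ^
2` further elements. -/
theorem exists_card_le_sq_add_one_forall_mem_iSup_range {V U : Type*} [AddCommGroup V] [Finite V]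
    [AddCommGroup U] [Finite U] (β : V →+ V →+ U) (hsymm : ∀ v v', β v v' = β v' v) {h : ℕ}
    (hβ : ∀ v, Nat.card (β v).range ≤ 2 ^ h) :
    ∃ W : Finset V, W.card ≤ h ^ 2 + 1 ∧ ∀ v v', β v v' ∈ ⨆ w ∈ W, (β w).range := by
  classical
  have := Fintype.ofFinite V
  obtain ⟨w, -, hw⟩ := Finset.exists_max_image Finset.univ
    (fun v : V => Nat.card (β v).range) ⟨0, Finset.mem_univ _⟩
  obtain ⟨g, hg⟩ := exists_fin_closure_range_eq_top_of_lt (A := (β w).range) (n := h)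
    ((hβ w).trans_lt (Nat.pow_lt_pow_right (by norm_num) (Nat.lt_succ_self h)))
  choose c hc using fun i => (g i).2
  -- the common annihilator of the `c i`
  let ψ : V →+ (∀ i, (β (c i)).range) := AddMonoidHom.mk' (fun v i => ⟨β (c i) v, v, rfl⟩)
    (fun a b => by ext i; simp)
  have hψ : ∀ k, ψ k = 0 → ∀ v, β k v ∈ (β w).range := by
    intro k hk
    have hkc : ∀ i, β k (c i) = 0 := fun i => by
      rw [hsymm]
      exact congrArg Subtype.val (congrFun hk i)
    have hle : (β w).range ≤ (β (w + k)).range := by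
      have h1 : (β w).range = AddSubgroup.closure (Set.range fun i => (g i : U)) :=
        (AddSubgroup.closure_range_coe hg).symm
      rw [h1, AddSubgroup.closure_le]
      rintro _ ⟨i, rfl⟩
      exact ⟨c i, by simp [hkc, hc]⟩
    have heq := AddSubgroup.eq_of_le_of_card_ge hle (hw _ (Finset.mem_univ _))
    intro v
    have : β k v = β (w + k) v - β w v := by simp
    rw [this]
    exact sub_mem (heq ▸ ⟨v, rfl⟩) ⟨v, rfl⟩
  obtain ⟨T, hT, hTc⟩ := exists_finset_closure_eq_top ψ.range
  have hcard : T.card ≤ h ^ 2 := by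
    have h1 : Nat.card ψ.range ≤ 2 ^ (h ^ 2) := by
      refine (AddSubgroup.natCard_le _).trans ?_
      rw [Nat.card_pi]
      refine (Finset.prod_le_pow_card _ _ _ fun i _ => hβ (c i)).trans ?_
      simp [← pow_mul, sq]
    exact (Nat.pow_le_pow_iff_right (by norm_num)).1 (hTc.trans h1)
  choose l hl using fun t : ψ.range => t.2
  refine ⟨insert w (T.image l), ?_, ?_⟩
  · exact (Finset.card_insert_le _ _).trans (Nat.succ_le_succ (Finset.card_image_le.trans hcard))
  set I := ⨆ x ∈ insert w (T.image l), (β x).range with hI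
  have hmem : ∀ x ∈ insert w (T.image l), ∀ v, β x v ∈ I := fun x hx v =>
    (le_iSup₂_of_le (f := fun x (_ : x ∈ insert w (T.image l)) => (β x).range) x hx le_rfl)
      ⟨v, rfl⟩
  have hw' : ∀ k, ψ k = 0 → ∀ v, β k v ∈ I := by
    intro k hk v
    obtain ⟨v', hv'⟩ := hψ k hk v
    rw [← hv']
    exact hmem w (by simp) v'
  have key : ∀ y : ψ.range, ∀ v : V, ψ v = y → ∀ v', β v v' ∈ I := by
    intro y
    have hy : y ∈ AddSubgroup.closure (T : Set ψ.range) := hT ▸ AddSubgroup.mem_top y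
    induction hy using AddSubgroup.closure_induction with
    | mem y hy =>
      intro v hv v'
      have : β v v' = β (v - l y) v' + β (l y) v' := by simp
      rw [this]
      exact add_mem (hw' _ (by rw [map_sub, hv, hl, sub_self]) _)
        (hmem _ (by simp only [Finset.mem_insert, Finset.mem_image]; exact .inr ⟨y, hy, rfl⟩) _)
    | zero => exact fun v hv => hw' v hv
    | add y z _ _ hy hz =>
      intro v hv v'
      have : β v v' = β (v - l y) v' + β (l y) v' := by simp
      rw [this]
      exact add_mem (hz _ (by rw [map_sub, hv, hl]; simp) _) (hy _ (hl y) _)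
    | neg y _ hy =>
      intro v hv v'
      have := hy (-v) (by simp [hv]) v'
      simpa using this
  exact fun v v' => key ⟨ψ v, v, rfl⟩ v rfl v'

/-- The factors receive distinct labels of `b` bits, and each bit gives one idempotent. These
produce all primitive idempotents; one more element, a generator of the unit group in every
coordinate, then gives every nonzero entry as a power. -/
theorem exists_finset_subring_closure_pi_eq_top {ι : Type*} [Finite ι] (F : ι → Type*)
    [∀ i, Field (F i)] [∀ i, Finite (F i)] {b : ℕ} (hb : Nat.card ι ≤ 2 ^ b) :
    ∃ W : Finset (∀ i, F i), W.card ≤ b + 1 ∧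
      Subring.closure (W : Set (∀ i, F i)) = ⊤ := by
  classical
  have := Fintype.ofFinite ι
  obtain ⟨f⟩ : Nonempty (ι ↪ (Fin b → Bool)) :=
    Function.Embedding.nonempty_of_card_le (by simpa [Nat.card_eq_fintype_card] using hb)
  let e : Fin b → ∀ i, F i := fun j i => if f i j then 1 else 0
  choose u hu using fun i => IsCyclic.exists_generator (α := (F i)ˣ)
  refine ⟨insert (fun i => (u i : F i)) (Finset.univ.image e), ?_, ?_⟩
  · refine (Finset.card_insert_le _ _).trans (Nat.succ_le_succ (Finset.card_image_le.trans ?_))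
    simp
  set W := insert (fun i => (u i : F i)) (Finset.univ.image e)
  set S := Subring.closure (W : Set (∀ i, F i))
  have hue : (fun i => (u i : F i)) ∈ S := Subring.subset_closure (by simp [W])
  have he : ∀ j, e j ∈ S := fun j => Subring.subset_closure (by simp [W])
  have hsingle : ∀ i, Pi.single i (1 : F i) ∈ S := by
    intro i
    -- Each `k ≠ i` differs from `i` in some bit, and that factor of the product vanishes at `k`.
    have : Pi.single i (1 : F i) = ∏ j, if f i j then e j else 1 - e j := by
      ext k
      rw [Finset.prod_apply]
      by_cases hk : k = i
      · subst hk
        rw [Pi.single_eq_same, Finset.prod_eq_one]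
        intro j _
        by_cases hj : f k j <;> simp [hj, e]
      · rw [Pi.single_eq_of_ne hk]
        obtain ⟨j, hj⟩ : ∃ j, f k j ≠ f i j := by
          by_contra! h
          exact hk (f.injective (funext h))
        symm
        refine Finset.prod_eq_zero (Finset.mem_univ j) ?_
        by_cases hij : f i j <;> simp_all [e]
    rw [this]
    refine prod_mem fun j _ => ?_
    split_ifs
    · exact he j
    · exact sub_mem (one_mem _) (he j)
  have hsingle' : ∀ i (a : F i), Pi.single i a ∈ S := by
    intro i a
    by_cases ha : a = 0
    · simp [ha, zero_mem]
    · obtain ⟨m, hm⟩ := (mem_powers_iff_mem_zpowers.2 (hu i (Units.mk0 a ha)))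
      have hm' : (u i : F i) ^ m = a := by
        simpa using congrArg Units.val hm
      have : Pi.single i a = Pi.single i (1 : F i) * (fun i => (u i : F i)) ^ m := by
        ext k
        by_cases hk : k = i
        · subst hk; simp [hm']
        · simp [hk]
      rw [this]
      exact mul_mem (hsingle i) (pow_mem hue m)
  rw [eq_top_iff]
  intro a _
  rw [← Finset.univ_sum_single a]
  exact sum_mem fun i _ => hsingle' i _

theorem exists_finset_subring_closure_add_nilradical (R : Type*) [CommRing R] [Finite R] {n b : ℕ}
    (hn : Nat.card R < 2 ^ (n + 1)) (hb : n ≤ 2 ^ b) :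
    ∃ W : Finset R, W.card ≤ b + 1 ∧
      ∀ r, ∃ s ∈ Subring.closure (W : Set R), r - s ∈ nilradical R := by
  classical
  let F := fun I : MaximalSpectrum R => R ⧸ I.asIdeal
  let _ : ∀ I, Field (F I) := fun I => Ideal.Quotient.field _
  have hfin : ∀ I, Finite (F I) := fun I =>
    Finite.of_surjective _ (Ideal.Quotient.mk_surjective (I := I.asIdeal))
  let q : R →+* ∀ I, F I :=
    (IsArtinianRing.quotNilradicalEquivPi R).toRingEquiv.toRingHom.comp
      (Ideal.Quotient.mk (nilradical R))
  have hq : Function.Surjective q :=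
    (IsArtinianRing.quotNilradicalEquivPi R).surjective.comp Ideal.Quotient.mk_surjective
  have hker : ∀ r, q r = 0 → r ∈ nilradical R := by
    intro r hr
    rw [← Ideal.Quotient.eq_zero_iff_mem]
    exact (IsArtinianRing.quotNilradicalEquivPi R).injective (by simpa [q] using hr)
  have := Fintype.ofFinite (MaximalSpectrum R)
  have hcard : Nat.card (MaximalSpectrum R) ≤ 2 ^ b := by
    refine le_trans ?_ hb
    have h1 : 2 ^ Nat.card (MaximalSpectrum R) ≤ Nat.card (∀ I, F I) := by
      rw [Nat.card_pi, Nat.card_eq_fintype_card]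
      refine Finset.pow_card_le_prod _ _ _ fun I _ => ?_
      exact Finite.one_lt_card
    have h2 := (h1.trans (Nat.card_le_card_of_surjective q hq)).trans_lt hn
    have := (Nat.pow_lt_pow_iff_right (by norm_num : 1 < 2)).1 h2
    omega
  obtain ⟨W, hWc, hW⟩ := exists_finset_subring_closure_pi_eq_top F hcard
  choose l hl using hq
  refine ⟨W.image l, Finset.card_image_le.trans hWc, fun r => ?_⟩
  have hmap : (Subring.closure ((W.image l : Finset R) : Set R)).map q = ⊤ := by
    rw [RingHom.map_closure, ← hW]
    congr 1
    ext a
    simp [hl]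
  obtain ⟨s, hs, hsr⟩ : q r ∈ (Subring.closure ((W.image l : Finset R) : Set R)).map q :=
    hmap ▸ Subring.mem_top _
  exact ⟨s, hs, hker _ (by rw [map_sub, hsr, sub_self])⟩

/-- Elements are added to `W` greedily while each multiplies the order of `(W)J` by `2 ^ h` on
average, which can happen at most `n / h` times. After that, multiplication by any element of `J`
has range of order at most `2 ^ h` modulo `(W)J`, and the lemma on bilinear maps supplies the
remaining `h ^ 2 + 1` elements. -/
theorem Ideal.exists_finset_span_mul_eq_mul_self {R : Type*} [CommRing R] [Finite R]
    (J : Ideal R) {n h : ℕ} (hn : Nat.card R < 2 ^ (n + 1)) (hh : 0 < h) :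
    ∃ W : Finset R, W.card ≤ n / h + (h ^ 2 + 1) ∧ (W : Set R) ⊆ J ∧
      Ideal.span (W : Set R) * J = J * J := by
  classical
  have := Fintype.ofFinite R
  obtain ⟨W, hW, hmax⟩ := Finset.exists_max_image
    (Finset.univ.filter fun W : Finset R => (W : Set R) ⊆ J ∧
      2 ^ (h * W.card) ≤ Nat.card (Ideal.span (W : Set R) * J : Ideal R)) Finset.card
    ⟨∅, by simp⟩
  simp only [Finset.mem_filter, Finset.mem_univ, true_and] at hW hmax
  obtain ⟨hWJ, hWc⟩ := hW
  set I : Ideal R := Ideal.span (W : Set R) * J with hI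
  let β : J →+ J →+ R ⧸ I := AddMonoidHom.mk' (fun v => AddMonoidHom.mk'
    (fun v' => Ideal.Quotient.mk I (v * v')) (fun a b => by simp [mul_add]))
    (fun a b => by ext c; simp [add_mul])
  have hβ : ∀ v v' : J, β v v' = Ideal.Quotient.mk I (v * v') := fun v v' => rfl
  have hfin : Finite (R ⧸ I) := Finite.of_surjective _ Ideal.Quotient.mk_surjective
  have hβc : ∀ v, Nat.card (β v).range ≤ 2 ^ h := by
    intro v
    choose l hl using fun y : (β v).range => y.2
    set I' : Ideal R := Ideal.span ((insert (v : R) W : Finset R) : Set R) * J with hI'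
    have hII' : I ≤ I' := Ideal.mul_mono_left (Ideal.span_mono (by simp))
    have hvI' : ∀ a : J, (v * a : R) ∈ I' := fun a =>
      Ideal.mul_mem_mul (Ideal.subset_span (by simp)) a.2
    -- Lifting the range of `β v` to `I'` shows that the order of `I'` is at least that of `I` times
    -- that of the range; a range larger than `2 ^ h` would allow `v` to join `W`.
    let F : I × (β v).range → I' := fun p => ⟨p.1 + v * l p.2, add_mem (hII' p.1.2) (hvI' _)⟩
    have hF : Function.Injective F := by
      rintro ⟨a, y⟩ ⟨a', y'⟩ hp
      have hp' : (a + v * l y : R) = a' + v * l y' := congrArg Subtype.val hp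
      have hyy : y = y' := by
        have := congrArg (Ideal.Quotient.mk I) hp'
        rw [map_add, map_add, Ideal.Quotient.eq_zero_iff_mem.2 a.2,
          Ideal.Quotient.eq_zero_iff_mem.2 a'.2, zero_add, zero_add, ← hβ, ← hβ, hl, hl] at this
        exact Subtype.ext this
      subst hyy
      exact Prod.ext (Subtype.ext (add_right_cancel hp')) rfl
    have hcard := Nat.card_le_card_of_injective F hF
    rw [Nat.card_prod] at hcard
    by_cases hvW : (v : R) ∈ W
    · have : I' = I := by rw [hI', Finset.insert_eq_of_mem hvW]
      rw [this] at hcard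
      have hpos : 0 < Nat.card I := Nat.card_pos
      have : Nat.card (β v).range ≤ 1 := by nlinarith
      exact this.trans Nat.one_le_two_pow
    · by_contra! hlt
      have := hmax (insert (v : R) W) ⟨by simp [Set.insert_subset_iff, hWJ], by
        rw [Finset.card_insert_of_notMem hvW, mul_add, mul_one, pow_add]
        exact (Nat.mul_le_mul hWc hlt.le).trans hcard⟩
      rw [Finset.card_insert_of_notMem hvW] at this
      omega
  obtain ⟨W', hW'c, hW'⟩ := exists_card_le_sq_add_one_forall_mem_iSup_range β
    (fun v v' => by rw [hβ, hβ, mul_comm]) hβc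
  have hJsub : ((W ∪ W'.image Subtype.val : Finset R) : Set R) ⊆ J := by
    intro a ha
    simp only [Finset.coe_union, Finset.coe_image, Set.mem_union, Set.mem_image] at ha
    rcases ha with ha | ⟨a, -, rfl⟩
    · exact hWJ ha
    · exact a.2
  refine ⟨W ∪ W'.image Subtype.val, ?_, hJsub, le_antisymm ?_ ?_⟩
  · refine (Finset.card_union_le _ _).trans (add_le_add ?_ (Finset.card_image_le.trans hW'c))
    rw [Nat.le_div_iff_mul_le hh, mul_comm]
    have h1 : Nat.card I ≤ Nat.card R := Nat.card_le_card_of_injective _ Subtype.val_injective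
    have := (Nat.pow_lt_pow_iff_right (by norm_num : 1 < 2)).1 ((hWc.trans h1).trans_lt hn)
    omega
  · exact Ideal.mul_mono_left (Ideal.span_le.2 hJsub)
  · set I' : Ideal R := Ideal.span ((W ∪ W'.image Subtype.val : Finset R) : Set R) * J
    have hII' : I ≤ I' := Ideal.mul_mono_left (Ideal.span_mono (by simp))
    have hle : (⨆ w ∈ W', (β w).range) ≤
        I'.toAddSubgroup.map (Ideal.Quotient.mk I : R →+* R ⧸ I).toAddMonoidHom := by
      refine iSup₂_le fun w hw => ?_
      rintro _ ⟨a, rfl⟩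
      exact ⟨w * a, Ideal.mul_mem_mul (Ideal.subset_span (by simp [hw])) a.2, rfl⟩
    refine Ideal.mul_le.2 fun v hv v' hv' => ?_
    obtain ⟨y, hy, hyv⟩ := hle (hW' ⟨v, hv⟩ ⟨v', hv'⟩)
    have h1 : v * v' - y ∈ I := by
      rw [← Ideal.Quotient.eq]
      exact hyv.symm
    have h2 := add_mem (hII' h1) hy
    rwa [sub_add_cancel] at h2

/-- Here `K` is the square of the nilradical `J` and the `x i` lift generators of J/J². `W` joins a
set `W₁` with J² = (W₁)J to a set `W₀` generating R modulo `J` as a ring. -/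
theorem exists_generators_of_finite_commRing (R : Type*) [CommRing R] [Finite R] {n b h : ℕ}
    (hn : Nat.card R < 2 ^ (n + 1)) (hb : n ≤ 2 ^ b) (hh : 0 < h) :
    ∃ W : Finset R, W.card ≤ n / h + (h ^ 2 + 1) + (b + 1) ∧
      ∃ (r : ℕ) (x : Fin r → R) (K : AddSubgroup R), (∀ i j, x i * x j ∈ K) ∧
        Nat.card K * 2 ^ r ≤ Nat.card R ∧
        ∀ H : AddSubgroup R, 1 ∈ H → (∀ i, x i ∈ H) → (∀ w ∈ W, ∀ a ∈ H, w * a ∈ H) → H = ⊤ := by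
  classical
  set J := nilradical R
  obtain ⟨W₁, hW₁c, hW₁J, hW₁⟩ := J.exists_finset_span_mul_eq_mul_self hn hh
  obtain ⟨W₀, hW₀c, hW₀⟩ := exists_finset_subring_closure_add_nilradical R hn hb
  have hfin : Finite (R ⧸ J * J) := Finite.of_surjective _ Ideal.Quotient.mk_surjective
  let π : R →+ R ⧸ J * J := (Ideal.Quotient.mk (J * J)).toAddMonoidHom
  obtain ⟨r, g, hg, hr⟩ := exists_fin_closure_range_eq_top (J.toAddSubgroup.map π)
  choose l hlJ hl using fun y : J.toAddSubgroup.map π => y.2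
  have hgen : ∀ v ∈ J, ∃ s ∈ AddSubgroup.closure (Set.range fun i => l (g i)), v - s ∈ J * J := by
    intro v hv
    have h1 : π v ∈ AddSubgroup.closure (Set.range fun i => (g i : R ⧸ J * J)) := by
      rw [AddSubgroup.closure_range_coe hg]
      exact ⟨v, hv, rfl⟩
    have h2 : (AddSubgroup.closure (Set.range fun i => l (g i))).map π =
        AddSubgroup.closure (Set.range fun i => (g i : R ⧸ J * J)) := by
      rw [AddMonoidHom.map_closure, ← Set.range_comp]
      congr 2
      ext i
      exact hl (g i)
    rw [← h2] at h1
    obtain ⟨s, hs, hsv⟩ := h1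
    exact ⟨s, hs, Ideal.Quotient.eq.1 hsv.symm⟩
  refine ⟨W₁ ∪ W₀, (Finset.card_union_le _ _).trans (add_le_add hW₁c hW₀c), r, fun i => l (g i),
    (J * J).toAddSubgroup, fun i j => Ideal.mul_mem_mul (hlJ _) (hlJ _), ?_, ?_⟩
  · let F : (J * J).toAddSubgroup × J.toAddSubgroup.map π → R := fun p => p.1 + l p.2
    have hF : Function.Injective F := by
      rintro ⟨a, y⟩ ⟨a', y'⟩ (hp : (a + l y : R) = a' + l y')
      have hyy : y = y' := by
        have := congrArg π hp
        rw [map_add, map_add, hl, hl, show π a = 0 from Ideal.Quotient.eq_zero_iff_mem.2 a.2,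
          show π a' = 0 from Ideal.Quotient.eq_zero_iff_mem.2 a'.2, zero_add, zero_add] at this
        exact Subtype.ext this
      subst hyy
      exact Prod.ext (Subtype.ext (add_right_cancel hp)) rfl
    have := Nat.card_le_card_of_injective F hF
    rw [Nat.card_prod] at this
    exact (Nat.mul_le_mul_left _ hr).trans this
  · intro H h1 hx hw
    have hxH : AddSubgroup.closure (Set.range fun i => l (g i)) ≤ H := by
      rw [AddSubgroup.closure_le]
      rintro _ ⟨i, rfl⟩
      exact hx i
    -- Successive approximation: J ⊆ H + J^(k+2). Since J² = (W₁)J and `H` is stable under `W₁`,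
    -- approximating the factor from `J` gains one power of `J` at each stage.
    have hpow : ∀ k : ℕ, ∀ v ∈ J, ∃ s ∈ H, v - s ∈ J ^ (k + 2) := by
      intro k
      induction k with
      | zero =>
        intro v hv
        obtain ⟨s, hs, hvs⟩ := hgen v hv
        exact ⟨s, hxH hs, by rwa [zero_add, pow_two]⟩
      | succ k ih =>
        have hsq : ∀ v ∈ J * J, ∃ s ∈ H, v - s ∈ J ^ (k + 1 + 2) := by
          intro v hv
          rw [← hW₁] at hv
          induction hv using Submodule.mul_induction_on' with
          | mem_mul_mem a ha c hc =>
            -- `H` is not an ideal, so a scalar `d` on the span side is moved into `c`, which must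
            -- therefore vary.
            induction ha using Submodule.span_induction generalizing c with
            | mem w hwW =>
              obtain ⟨s, hs, hcs⟩ := ih c hc
              refine ⟨w * s, hw w (by simpa using .inl hwW) s hs, ?_⟩
              rw [← mul_sub, show k + 1 + 2 = (k + 2) + 1 by ring, pow_succ']
              exact Ideal.mul_mem_mul (hW₁J hwW) hcs
            | zero => exact ⟨0, zero_mem _, by simp⟩
            | add p q _ _ hp hq =>
              obtain ⟨s, hs, hps⟩ := hp c hc
              obtain ⟨t, ht, hqt⟩ := hq c hc
              exact ⟨s + t, add_mem hs ht, by
                rw [show (p + q) * c - (s + t) = (p * c - s) + (q * c - t) by ring]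
                exact add_mem hps hqt⟩
            | smul d p _ hp =>
              obtain ⟨s, hs, hps⟩ := hp (d * c) (Ideal.mul_mem_left _ _ hc)
              exact ⟨s, hs, by
                rwa [show d • p * c - s = p * (d * c) - s by rw [smul_eq_mul]; ring]⟩
          | add p _ q _ hp hq =>
            obtain ⟨s, hs, hps⟩ := hp
            obtain ⟨t, ht, hqt⟩ := hq
            exact ⟨s + t, add_mem hs ht, by
              rw [show p + q - (s + t) = (p - s) + (q - t) by ring]
              exact add_mem hps hqt⟩
        intro v hv
        obtain ⟨s, hs, hvs⟩ := hgen v hv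
        obtain ⟨t, ht, hvt⟩ := hsq _ hvs
        exact ⟨s + t, add_mem (hxH hs) ht, by rwa [← sub_sub]⟩
    obtain ⟨m, hm⟩ : IsNilpotent J := IsArtinianRing.isNilpotent_nilradical
    have hJH : ∀ v ∈ J, v ∈ H := by
      intro v hv
      obtain ⟨s, hs, hvs⟩ := hpow m v hv
      have h0 : v - s = 0 := by
        have : J ^ (m + 2) = 0 := by rw [pow_add, hm, zero_mul]
        simpa [this] using hvs
      rwa [sub_eq_zero.1 h0]
    have hS : ∀ s ∈ Subring.closure (W₀ : Set R), ∀ a ∈ H, s * a ∈ H := by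
      intro s hs
      induction hs using Subring.closure_induction with
      | mem w hwW => exact hw w (by simpa using .inr hwW)
      | zero => simp [zero_mem]
      | one => simp
      | add p q _ _ hp hq =>
        intro a ha
        rw [add_mul]
        exact add_mem (hp a ha) (hq a ha)
      | neg p _ hp =>
        intro a ha
        rw [neg_mul]
        exact neg_mem (hp a ha)
      | mul p q _ _ hp hq =>
        intro a ha
        rw [mul_assoc]
        exact hp _ (hq a ha)
    rw [eq_top_iff]
    intro a _
    obtain ⟨s, hs, has⟩ := hW₀ a
    have h2 := add_mem (hJH _ has) (hS s hs 1 h1)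
    rwa [mul_one, sub_add_cancel] at h2

/-! ### Encoding rings by finite data and counting the codes -/

/-- The elements multiplied correctly by a given `x j` form an additive subgroup with the closure
properties of `hgen`, hence everything. So the elements `a` that multiply every `b` correctly
include all `x j`, and `hgen` applies a second time. -/
theorem map_mul_of_generators {R S ι κ : Type*} [CommRing R] [CommRing S] (θ : R →+ S)
    {w : ι → R} {w' : ι → S} {x : κ → R} {x' : κ → S} (h1 : θ 1 = 1)
    (hw : ∀ i a, θ (w i * a) = w' i * θ a) (hx : ∀ i, θ (x i) = x' i)
    (hxx : ∀ i j, θ (x i * x j) = x' i * x' j)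
    (hgen : ∀ H : AddSubgroup R, 1 ∈ H → (∀ i, x i ∈ H) → (∀ i, ∀ a ∈ H, w i * a ∈ H) → H = ⊤)
    (a b : R) : θ (a * b) = θ a * θ b := by
  have hx' : ∀ j b, θ (x j * b) = θ (x j) * θ b := by
    intro j
    let H : AddSubgroup R :=
      { carrier := {b | θ (x j * b) = θ (x j) * θ b}
        zero_mem' := by simp
        add_mem' := by
          intro p q (hp : _ = _) (hq : _ = _)
          simp only [Set.mem_ofPred_eq, mul_add, map_add, hp, hq]
        neg_mem' := by
          intro p (hp : _ = _)
          simp only [Set.mem_ofPred_eq, mul_neg, map_neg, hp] }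
    have hH : H = ⊤ := by
      refine hgen H ?_ ?_ ?_
      · change θ (x j * 1) = θ (x j) * θ 1
        rw [mul_one, h1, mul_one]
      · intro i
        change θ (x j * x i) = θ (x j) * θ (x i)
        rw [hxx, hx, hx]
      · intro i p (hp : _ = _)
        change θ (x j * (w i * p)) = θ (x j) * θ (w i * p)
        rw [mul_left_comm, hw, hp, hw, mul_left_comm]
    exact fun b => (hH ▸ AddSubgroup.mem_top b : b ∈ H)
  let H : AddSubgroup R :=
    { carrier := {a | ∀ b, θ (a * b) = θ a * θ b}
      zero_mem' := by simp
      add_mem' := by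
        intro p q hp hq b
        rw [add_mul, map_add, map_add, hp, hq, add_mul]
      neg_mem' := by
        intro p hp b
        rw [neg_mul, map_neg, map_neg, hp, neg_mul] }
  have hH : H = ⊤ := by
    refine hgen H ?_ hx' ?_
    · intro b
      rw [one_mul, h1, one_mul]
    · intro i p hp b
      rw [mul_assoc, hw, hp, hw, mul_assoc]
  exact (hH ▸ AddSubgroup.mem_top a : a ∈ H) b

/-- Lists of at most `n` cyclic groups of order at most `N`. -/
abbrev CyclicFactors (N n : ℕ) : Type := Σ k : Fin (n + 1), Fin k → Fin N

/-- The direct product of a list of cyclic groups. -/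
abbrev CyclicFactors.Group {N n : ℕ} (c : CyclicFactors N n) : Type :=
  ∀ i : Fin c.1, ZMod (c.2 i + 1)

theorem exists_cyclicFactors_addEquiv {A : Type*} [AddCommGroup A] [Finite A] {N n : ℕ}
    (hA : Nat.card A ≤ N) (hN : N < 2 ^ (n + 1)) :
    ∃ c : CyclicFactors N n, Nonempty (A ≃+ c.Group) := by
  classical
  obtain ⟨ι, _, m, hm, ⟨e⟩⟩ := AddCommGroup.equiv_directSum_zmod_of_finite' A
  have e' : A ≃+ ∀ i, ZMod (m i) := e.trans (DirectSum.addEquivProd fun i => ZMod (m i))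
  have hcard : Nat.card A = ∏ i, m i := by
    rw [Nat.card_congr e'.toEquiv, Nat.card_pi]
    simp
  have hι : Fintype.card ι ≤ n := by
    have h1 : 2 ^ Fintype.card ι ≤ ∏ i, m i := Finset.pow_card_le_prod _ _ _ fun i _ => hm i
    rw [← hcard] at h1
    have := (Nat.pow_lt_pow_iff_right (by norm_num : 1 < 2)).1 ((h1.trans hA).trans_lt hN)
    omega
  have hmN : ∀ i, m i ≤ N := by
    intro i
    refine le_trans ?_ hA
    rw [hcard]
    exact Nat.le_of_dvd (Finset.prod_pos fun j _ => (hm j).le) (Finset.dvd_prod_of_mem _ (by simp))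
  let σ := Fintype.equivFin ι
  -- A factor of order `m` is coded by `m - 1`, matching the shift that keeps `ZMod 0` out of the
  -- list.
  refine ⟨⟨⟨Fintype.card ι, by omega⟩, fun j => ⟨m (σ.symm j) - 1, by
    have := hm (σ.symm j); have := hmN (σ.symm j); omega⟩⟩, ⟨e'.trans ?_⟩⟩
  refine AddEquiv.symm ((AddEquiv.piCongrRight fun j => (ZMod.ringEquivCongr ?_).toAddEquiv).trans
    ((RingEquiv.piCongrLeft (fun i => ZMod (m i)) σ.symm).toAddEquiv))
  have := hm (σ.symm j)
  simp only
  omega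

/-- Data describing a commutative ring of order at most `N` up to isomorphism. -/
abbrev CommRingCode (N n t : ℕ) : Type :=
  Σ (c : {c : CyclicFactors N n // Nat.card c.Group ≤ N}) (r : Fin (n + 1))
    (K : {K : AddSubgroup c.1.Group // Nat.card K * 2 ^ (r : ℕ) ≤ N}),
    (Fin t → c.1.Group →+ c.1.Group) × c.1.Group × (Fin r → c.1.Group) × (Sym2 (Fin r) → K.1)

/-- The code `d` describes the ring `R`. -/
def CommRingCode.Describes {N n t : ℕ} (d : CommRingCode N n t) (R : Type*) [CommRing R] : Prop :=
  ∃ (e : R ≃+ d.1.1.Group) (w : Fin t → R) (x : Fin d.2.1 → R),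
    (∀ i a, e (w i * a) = d.2.2.2.1 i (e a)) ∧ e 1 = d.2.2.2.2.1 ∧
    (∀ i, e (x i) = d.2.2.2.2.2.1 i) ∧ (∀ i j, e (x i * x j) = d.2.2.2.2.2.2 s(i, j)) ∧
    ∀ H : AddSubgroup R, 1 ∈ H → (∀ i, x i ∈ H) → (∀ i, ∀ a ∈ H, w i * a ∈ H) → H = ⊤

theorem CommRingCode.Describes.ringEquiv {N n t : ℕ} {d : CommRingCode N n t} {R S : Type*}
    [CommRing R] [CommRing S] (hR : d.Describes R) (hS : d.Describes S) : Nonempty (R ≃+* S) := by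
  obtain ⟨e, w, x, hw, h1, hx, hxx, hgen⟩ := hR
  obtain ⟨e', w', x', hw', h1', hx', hxx', -⟩ := hS
  let θ : R ≃+ S := e.trans e'.symm
  have hmul : ∀ a b, θ (a * b) = θ a * θ b := by
    refine map_mul_of_generators θ.toAddMonoidHom (w := w) (w' := w') (x := x) (x' := x')
      ?_ ?_ ?_ ?_ hgen
    · exact e'.injective (by simp [θ, h1, h1'])
    · exact fun i a => e'.injective (by simp [θ, hw, hw'])
    · exact fun i => e'.injective (by simp [θ, hx, hx'])
    · exact fun i j => e'.injective (by simp [θ, hxx, hxx'])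
  exact ⟨{ θ with map_mul' := hmul }⟩

theorem Finset.exists_fin_subset_range {α : Type*} [Zero α] (W : Finset α) {t : ℕ}
    (h : W.card ≤ t) : ∃ w : Fin t → α, (W : Set α) ⊆ Set.range w := by
  refine ⟨fun i => if h : i.1 < W.card then W.equivFin.symm ⟨i, h⟩ else 0, fun a ha => ?_⟩
  exact ⟨⟨W.equivFin ⟨a, ha⟩, (W.equivFin ⟨a, ha⟩).2.trans_le h⟩, by simp⟩

theorem exists_commRingCode_describes (R : Type*) [CommRing R] [Finite R] {N n b h t : ℕ}
    (hR : Nat.card R ≤ N) (hN : N < 2 ^ (n + 1)) (hb : n ≤ 2 ^ b) (hh : 0 < h)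
    (ht : n / h + (h ^ 2 + 1) + (b + 1) ≤ t) : ∃ d : CommRingCode N n t, d.Describes R := by
  obtain ⟨W, hW, r, x, K, hK, hKr, hgen⟩ :=
    exists_generators_of_finite_commRing R (hR.trans_lt hN) hb hh
  obtain ⟨w, hw⟩ := W.exists_fin_subset_range (hW.trans ht)
  obtain ⟨c, ⟨e⟩⟩ := exists_cyclicFactors_addEquiv hR hN
  have hr : r < n + 1 := by
    have h1 : 0 < Nat.card K := Nat.card_pos
    have h2 : 2 ^ r ≤ Nat.card K * 2 ^ r := Nat.le_mul_of_pos_left _ h1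
    exact (Nat.pow_lt_pow_iff_right (by norm_num : 1 < 2)).1
      ((h2.trans (hKr.trans hR)).trans_lt hN)
  have hKc : Nat.card (K.map e.toAddMonoidHom) = Nat.card K :=
    (Nat.card_congr (K.equivMapOfInjective e.toAddMonoidHom e.injective).toEquiv).symm
  let K' : AddSubgroup c.Group := K.map e.toAddMonoidHom
  let f : Sym2 (Fin r) → K' := Sym2.lift ⟨fun i j => ⟨e (x i * x j), x i * x j, hK i j, rfl⟩,
    fun i j => by simp only [mul_comm]⟩
  refine ⟨⟨⟨c, by rwa [← Nat.card_congr e.toEquiv]⟩, ⟨r, hr⟩, ⟨K', by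
    rw [hKc]; exact hKr.trans hR⟩, fun i => (e.toAddMonoidHom.comp (AddMonoidHom.mulLeft (w i))).comp
      e.symm.toAddMonoidHom, e 1, fun i => e (x i), f⟩, e, w, x, ?_, rfl, fun _ => rfl,
      fun _ _ => rfl, ?_⟩
  · intro i a
    simp
  · intro H h1 hx hwH
    refine hgen H h1 hx fun v hv a ha => ?_
    obtain ⟨i, rfl⟩ := hw hv
    exact hwH i a ha

theorem Nat.card_sigma_le {α : Type*} {β : α → Type*} [Finite α] [∀ a, Finite (β a)] {B : ℕ}
    (h : ∀ a, Nat.card (β a) ≤ B) : Nat.card (Sigma β) ≤ Nat.card α * B := by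
  have := Fintype.ofFinite α
  rw [Nat.card_sigma, Nat.card_eq_fintype_card, ← smul_eq_mul]
  exact Finset.sum_le_card_nsmul _ _ _ fun a _ => h a

instance {N n : ℕ} (c : CyclicFactors N n) : Finite c.Group :=
  Pi.finite

instance CommRingCode.finite (N n t : ℕ) : Finite (CommRingCode N n t) := by
  have (c : CyclicFactors N n) : Finite (c.Group →+ c.Group) :=
    Finite.of_injective _ DFunLike.coe_injective
  infer_instance

/-- The factors bound, in order, the additive group, the rank `r`, the subgroup `K`, the `t`
endomorphisms, the identity, the `x i` and the table of products. Only `B` contributes to the main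
term; using unordered pairs in it halves the leading exponent. -/
theorem CommRingCode.card_le {N n t B : ℕ} (hN0 : 0 < N) (hN : N < 2 ^ (n + 1))
    (hB : ∀ r κ : ℕ, r ≤ n → 0 < κ → κ * 2 ^ r ≤ N → κ ^ (r + 1).choose 2 ≤ B) :
    Nat.card (CommRingCode N n t) ≤
      ((n + 1) * N ^ n) * ((n + 1) * (N ^ n * ((N ^ n) ^ t * (N * (N ^ n * B))))) := by
  have hfin (c : CyclicFactors N n) : Finite (c.Group →+ c.Group) :=
    Finite.of_injective _ DFunLike.coe_injective
  have hc : Nat.card {c : CyclicFactors N n // Nat.card c.Group ≤ N} ≤ (n + 1) * N ^ n := by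
    refine (Nat.card_le_card_of_injective _ Subtype.val_injective).trans ?_
    refine (Nat.card_sigma_le (B := N ^ n) fun k => ?_).trans (by simp)
    simpa [Nat.card_fun] using Nat.pow_le_pow_right hN0 (Nat.lt_succ_iff.1 k.2)
  refine (Nat.card_sigma_le fun c => ?_).trans (Nat.mul_le_mul_right _ hc)
  have hcn : Nat.card c.1.Group < 2 ^ (n + 1) := c.2.trans_lt hN
  refine (Nat.card_sigma_le (B := N ^ n * ((N ^ n) ^ t * (N * (N ^ n * B)))) fun r => ?_).trans
    (by simp)
  have hK : Nat.card {K : AddSubgroup c.1.Group // Nat.card K * 2 ^ (r : ℕ) ≤ N} ≤ N ^ n :=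
    (Nat.card_le_card_of_injective _ Subtype.val_injective).trans
      ((card_addSubgroup_le hcn).trans (Nat.pow_le_pow_left c.2 n))
  refine (Nat.card_sigma_le fun K => ?_).trans (Nat.mul_le_mul_right _ hK)
  simp only [Nat.card_prod, Nat.card_fun, Nat.card_eq_fintype_card (α := Fin _), Fintype.card_fin]
  refine Nat.mul_le_mul ?_ (Nat.mul_le_mul c.2 (Nat.mul_le_mul ?_ ?_))
  · exact Nat.pow_le_pow_left ((card_addMonoidHom_le hcn).trans (Nat.pow_le_pow_left c.2 n)) t
  · exact (Nat.pow_le_pow_left c.2 _).trans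
      (Nat.pow_le_pow_right hN0 (Nat.lt_succ_iff.1 r.2))
  · rw [Nat.card_eq_fintype_card (α := Sym2 _), Sym2.card, Fintype.card_fin]
    exact hB r _ (Nat.lt_succ_iff.1 r.2) Nat.card_pos K.2

theorem finite_quotient_and_numCommRings_le {N n b h t : ℕ} (hN : N < 2 ^ (n + 1))
    (hb : n ≤ 2 ^ b) (hh : 0 < h) (ht : n / h + (h ^ 2 + 1) + (b + 1) ≤ t) :
    Finite (Quotient (finCommRingSetoid N)) ∧ numCommRings N ≤ Nat.card (CommRingCode N n t) := by
  have hex : ∀ c : Quotient (finCommRingSetoid N), ∃ d : CommRingCode N n t, d.Describes c.out.1 :=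
    fun c => by
      have := c.out.2.1
      exact exists_commRingCode_describes _ c.out.2.2 hN hb hh ht
  choose d hd using hex
  have hinj : Function.Injective d := by
    intro c c' hcc
    rw [← c.out_eq, ← c'.out_eq]
    exact Quotient.sound ((hd c).ringEquiv (hcc ▸ hd c'))
  exact ⟨Finite.of_injective d hinj, Nat.card_le_card_of_injective d hinj⟩

/-! ### Many rings from symmetric bilinear forms over 𝔽₂ -/

/-- The bilinear form with values in `𝔽₂ ^ s` with prescribed values on pairs of basis vectors. -/
def symmForm {r s : ℕ} (b : Sym2 (Fin r) → Fin s → ZMod 2) (v v' : Fin r → ZMod 2) :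
    Fin s → ZMod 2 :=
  ∑ i, ∑ j, (v i * v' j) • b s(i, j)

section symmForm

variable {r s : ℕ} (b : Sym2 (Fin r) → Fin s → ZMod 2)

theorem symmForm_comm (v v' : Fin r → ZMod 2) : symmForm b v v' = symmForm b v' v := by
  rw [symmForm, symmForm, Finset.sum_comm]
  simp only [mul_comm, Sym2.eq_swap]

theorem symmForm_add_left (v₁ v₂ v' : Fin r → ZMod 2) :
    symmForm b (v₁ + v₂) v' = symmForm b v₁ v' + symmForm b v₂ v' := by
  simp only [symmForm, Pi.add_apply, add_mul, add_smul, Finset.sum_add_distrib]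

theorem symmForm_smul_left (a : ZMod 2) (v v' : Fin r → ZMod 2) :
    symmForm b (a • v) v' = a • symmForm b v v' := by
  simp only [symmForm, Pi.smul_apply, smul_eq_mul, mul_assoc, mul_smul, Finset.smul_sum]

theorem symmForm_add_right (v v₁ v₂ : Fin r → ZMod 2) :
    symmForm b v (v₁ + v₂) = symmForm b v v₁ + symmForm b v v₂ := by
  rw [symmForm_comm, symmForm_add_left, symmForm_comm, symmForm_comm b v₂]

theorem symmForm_smul_right (a : ZMod 2) (v v' : Fin r → ZMod 2) :
    symmForm b v (a • v') = a • symmForm b v v' := by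
  rw [symmForm_comm, symmForm_smul_left, symmForm_comm]

theorem symmForm_zero_left (v : Fin r → ZMod 2) : symmForm b 0 v = 0 := by
  simp [symmForm]

theorem symmForm_single_single (i j : Fin r) :
    symmForm b (Pi.single i 1) (Pi.single j 1) = b s(i, j) := by
  rw [symmForm, Finset.sum_eq_single i, Finset.sum_eq_single j] <;>
    simp +contextual [Pi.single_apply]

end symmForm

/-- The local `𝔽₂`-algebra `𝔽₂ ⊕ V ⊕ U` whose maximal ideal `V ⊕ U` has the multiplication
`V × V → U` given by `b`. -/
def FormAlgebra {r s : ℕ} (_ : Sym2 (Fin r) → Fin s → ZMod 2) : Type :=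
  ZMod 2 × (Fin r → ZMod 2) × (Fin s → ZMod 2)

namespace FormAlgebra

variable {r s : ℕ} (b : Sym2 (Fin r) → Fin s → ZMod 2)

instance : AddCommGroup (FormAlgebra b) :=
  inferInstanceAs (AddCommGroup (ZMod 2 × (Fin r → ZMod 2) × (Fin s → ZMod 2)))

instance : Finite (FormAlgebra b) :=
  inferInstanceAs (Finite (ZMod 2 × (Fin r → ZMod 2) × (Fin s → ZMod 2)))

instance : Mul (FormAlgebra b) where
  mul p q := (p.1 * q.1, p.1 • q.2.1 + q.1 • p.2.1,
    p.1 • q.2.2 + q.1 • p.2.2 + symmForm b p.2.1 q.2.1)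

instance : One (FormAlgebra b) where
  one := (1, 0, 0)

variable {b}

theorem ext {p q : FormAlgebra b} (h₁ : p.1 = q.1) (h₂ : p.2.1 = q.2.1) (h₃ : p.2.2 = q.2.2) :
    p = q :=
  Prod.ext h₁ (Prod.ext h₂ h₃)

theorem one_fst : (1 : FormAlgebra b).1 = 1 := rfl
theorem one_snd_fst : (1 : FormAlgebra b).2.1 = 0 := rfl
theorem one_snd_snd : (1 : FormAlgebra b).2.2 = 0 := rfl
theorem zero_fst : (0 : FormAlgebra b).1 = 0 := rfl
theorem zero_snd_fst : (0 : FormAlgebra b).2.1 = 0 := rfl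
theorem zero_snd_snd : (0 : FormAlgebra b).2.2 = 0 := rfl
theorem add_fst (p q : FormAlgebra b) : (p + q).1 = p.1 + q.1 := rfl
theorem add_snd_fst (p q : FormAlgebra b) : (p + q).2.1 = p.2.1 + q.2.1 := rfl
theorem add_snd_snd (p q : FormAlgebra b) : (p + q).2.2 = p.2.2 + q.2.2 := rfl
theorem mul_fst (p q : FormAlgebra b) : (p * q).1 = p.1 * q.1 := rfl
theorem mul_snd_fst (p q : FormAlgebra b) : (p * q).2.1 = p.1 • q.2.1 + q.1 • p.2.1 := rfl
theorem mul_snd_snd (p q : FormAlgebra b) :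
    (p * q).2.2 = p.1 • q.2.2 + q.1 • p.2.2 + symmForm b p.2.1 q.2.1 := rfl

protected theorem mul_comm (p q : FormAlgebra b) : p * q = q * p := by
  refine ext ?_ ?_ ?_
  · rw [mul_fst, mul_fst, mul_comm]
  · rw [mul_snd_fst, mul_snd_fst, add_comm]
  · rw [mul_snd_snd, mul_snd_snd, symmForm_comm, add_comm (p.1 • _)]

protected theorem add_mul (p q t : FormAlgebra b) : (p + q) * t = p * t + q * t := by
  refine ext ?_ ?_ ?_
  · simp only [mul_fst, add_fst, add_mul]
  · simp only [mul_snd_fst, add_fst, add_snd_fst, add_smul, smul_add]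
    abel
  · simp only [mul_snd_snd, add_fst, add_snd_fst, add_snd_snd, add_smul, smul_add,
      symmForm_add_left]
    abel

/-- A product of three elements of V ⊕ U vanishes under either bracketing, so only bilinearity of
the form is needed. -/
protected theorem mul_assoc (p q t : FormAlgebra b) : p * q * t = p * (q * t) := by
  refine ext ?_ ?_ ?_
  · simp only [mul_fst, mul_assoc]
  · simp only [mul_fst, mul_snd_fst, smul_add, smul_smul, mul_comm]
    abel
  · simp only [mul_fst, mul_snd_fst, mul_snd_snd, smul_add, smul_smul, symmForm_add_left,
      symmForm_add_right, symmForm_smul_left, symmForm_smul_right, mul_comm]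
    abel

protected theorem one_mul (p : FormAlgebra b) : 1 * p = p := by
  refine ext ?_ ?_ ?_
  · simp [mul_fst, one_fst]
  · simp [mul_snd_fst, one_fst, one_snd_fst]
  · simp [mul_snd_snd, one_fst, one_snd_fst, one_snd_snd, symmForm_zero_left]

protected theorem zero_mul (p : FormAlgebra b) : 0 * p = 0 := by
  refine ext ?_ ?_ ?_
  · simp [mul_fst, zero_fst]
  · simp [mul_snd_fst, zero_fst, zero_snd_fst]
  · simp [mul_snd_snd, zero_fst, zero_snd_fst, zero_snd_snd, symmForm_zero_left]

instance : CommRing (FormAlgebra b) :=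
  { (inferInstance : AddCommGroup (FormAlgebra b)), (inferInstance : Mul (FormAlgebra b)),
    (inferInstance : One (FormAlgebra b)) with
    mul_assoc := FormAlgebra.mul_assoc
    mul_comm := FormAlgebra.mul_comm
    one_mul := FormAlgebra.one_mul
    mul_one := fun p => by rw [FormAlgebra.mul_comm, FormAlgebra.one_mul]
    right_distrib := FormAlgebra.add_mul
    left_distrib := fun p q t => by
      rw [FormAlgebra.mul_comm, FormAlgebra.add_mul, FormAlgebra.mul_comm q,
        FormAlgebra.mul_comm t]
    zero_mul := FormAlgebra.zero_mul
    mul_zero := fun p => by rw [FormAlgebra.mul_comm, FormAlgebra.zero_mul] }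

theorem natCard (b : Sym2 (Fin r) → Fin s → ZMod 2) :
    Nat.card (FormAlgebra b) = 2 ^ (1 + r + s) := by
  change Nat.card (ZMod 2 × (Fin r → ZMod 2) × (Fin s → ZMod 2)) = _
  simp only [Nat.card_prod, Nat.card_fun, Nat.card_zmod, Nat.card_fin]
  ring

/-- The identification of the underlying additive groups. -/
def toProd (b : Sym2 (Fin r) → Fin s → ZMod 2) :
    FormAlgebra b ≃+ ZMod 2 × (Fin r → ZMod 2) × (Fin s → ZMod 2) :=
  AddEquiv.refl _

theorem eq_of_forall_mul_eq {b b' : Sym2 (Fin r) → Fin s → ZMod 2}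
    (h : ∀ p q, toProd b ((toProd b).symm p * (toProd b).symm q) =
      toProd b' ((toProd b').symm p * (toProd b').symm q)) : b = b' := by
  funext z
  induction z with
  | _ i j =>
    have h1 := congrArg (fun p => p.2.2) (h (0, Pi.single i 1, 0) (0, Pi.single j 1, 0))
    change (0 : ZMod 2) • (0 : Fin s → ZMod 2) + (0 : ZMod 2) • (0 : Fin s → ZMod 2) +
        symmForm b (Pi.single i 1) (Pi.single j 1) =
      (0 : ZMod 2) • (0 : Fin s → ZMod 2) + (0 : ZMod 2) • (0 : Fin s → ZMod 2) +
        symmForm b' (Pi.single i 1) (Pi.single j 1) at h1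
    simpa [symmForm_single_single] using h1

end FormAlgebra

/-- A form is recovered from its isomorphism class and an isomorphism from a fixed representative of
that class, read as an additive endomorphism of `A`: transporting the multiplication along it gives
back the form. -/
theorem two_pow_le_numCommRings_mul {N r s : ℕ} [Finite (Quotient (finCommRingSetoid N))]
    (hN : 2 ^ (1 + r + s) ≤ N) :
    2 ^ (s * (r + 1).choose 2) ≤ numCommRings N * 2 ^ (1 + r + s) ^ 2 := by
  let A := ZMod 2 × (Fin r → ZMod 2) × (Fin s → ZMod 2)
  let B := Sym2 (Fin r) → Fin s → ZMod 2
  let cls : B → Quotient (finCommRingSetoid N) := fun b => Quotient.mk _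
    ⟨CommRingCat.of (FormAlgebra b), inferInstanceAs (Finite (FormAlgebra b)),
      (FormAlgebra.natCard b).trans_le hN⟩
  -- The representative depends only on the class, so forms in one class share the source of their
  -- isomorphisms.
  let rep : B → B := fun b => Function.invFun cls (cls b)
  have hrep : ∀ b, cls (rep b) = cls b := fun b => Function.invFun_eq ⟨b, rfl⟩
  have hiso : ∀ b, Nonempty (FormAlgebra (rep b) ≃+* FormAlgebra b) :=
    fun b => Quotient.exact (hrep b)
  let φ : ∀ b, FormAlgebra (rep b) ≃+* FormAlgebra b := fun b => (hiso b).some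
  let F : B → Quotient (finCommRingSetoid N) × (A →+ A) := fun b => (cls b,
    (((FormAlgebra.toProd (rep b)).symm.trans (φ b).toAddEquiv).trans
      (FormAlgebra.toProd b)).toAddMonoidHom)
  have hF : Function.Injective F := by
    intro b b' hbb
    have hc : cls b = cls b' := congrArg Prod.fst hbb
    have hr : rep b = rep b' := congrArg (Function.invFun cls) hc
    have hφ : ∀ p, FormAlgebra.toProd b (φ b ((FormAlgebra.toProd (rep b)).symm p)) =
        FormAlgebra.toProd b' (φ b' ((FormAlgebra.toProd (rep b')).symm p)) :=
      fun p => DFunLike.congr_fun (congrArg Prod.snd hbb) p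
    clear_value φ
    generalize φ b = f at hφ
    generalize φ b' = f' at hφ
    generalize rep b = c at *
    subst hr
    refine FormAlgebra.eq_of_forall_mul_eq fun p q => ?_
    have key : ∀ p, ∃ x, f x = (FormAlgebra.toProd b).symm p ∧
        f' x = (FormAlgebra.toProd b').symm p := by
      intro p
      refine ⟨f.symm ((FormAlgebra.toProd b).symm p), by simp, ?_⟩
      have := hφ (FormAlgebra.toProd _ (f.symm ((FormAlgebra.toProd b).symm p)))
      simp only [AddEquiv.symm_apply_apply, RingEquiv.apply_symm_apply,
        AddEquiv.apply_symm_apply] at this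
      rw [AddEquiv.eq_symm_apply]
      exact this.symm
    obtain ⟨x, hx, hx'⟩ := key p
    obtain ⟨y, hy, hy'⟩ := key q
    rw [← hx, ← hx', ← hy, ← hy', ← map_mul, ← map_mul]
    simpa using hφ (FormAlgebra.toProd _ (x * y))
  have hA : Nat.card A = 2 ^ (1 + r + s) := FormAlgebra.natCard (fun _ => 0)
  have hfin : Finite (A →+ A) := Finite.of_injective _ DFunLike.coe_injective
  have hB : Nat.card B = 2 ^ (s * (r + 1).choose 2) := by
    rw [Nat.card_fun, Nat.card_fun, Nat.card_zmod, Nat.card_fin,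
      Nat.card_eq_fintype_card (α := Sym2 _), Sym2.card, Fintype.card_fin, ← pow_mul]
  rw [← hB]
  refine (Nat.card_le_card_of_injective F hF).trans ?_
  rw [Nat.card_prod]
  refine Nat.mul_le_mul_left _ ?_
  refine (card_addMonoidHom_le (n := 1 + r + s) ?_).trans ?_
  · rw [hA]
    exact Nat.pow_lt_pow_right (by norm_num) (Nat.lt_succ_self _)
  · rw [hA, ← pow_mul, sq]

/-! ### Asymptotic estimates -/

theorem Nat.log_two_mul_log_le {N : ℕ} (hN : N ≠ 0) :
    (Nat.log 2 N : ℝ) * Real.log 2 ≤ Real.log N := by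
  rw [← Real.log_pow]
  exact Real.log_le_log (by positivity) (by exact_mod_cast Nat.pow_log_le_self 2 hN)

theorem finite_quotient_finCommRingSetoid (N : ℕ) : Finite (Quotient (finCommRingSetoid N)) :=
  -- Only finiteness matters here, so the crude choice `b = n`, `h = 1` suffices.
  (finite_quotient_and_numCommRings_le (Nat.lt_pow_succ_log_self one_lt_two N)
    Nat.lt_two_pow_self.le one_pos le_rfl).1

theorem numCommRings_pos {N : ℕ} (hN : 1 ≤ N) : 0 < numCommRings N := by
  have := finite_quotient_finCommRingSetoid N
  have : Nonempty (Quotient (finCommRingSetoid N)) :=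
    ⟨Quotient.mk _ ⟨CommRingCat.of PUnit, inferInstanceAs (Finite PUnit), by
      change Nat.card PUnit ≤ N
      simpa using hN⟩⟩
  exact Nat.card_pos

/-- The cubic `y ↦ y ^ 2 * (L - y)` on the nonnegative axis is maximal at `2 * L / 3`. -/
theorem sq_mul_sub_le {L y : ℝ} (hL : 0 ≤ L) (hy : 0 ≤ y) :
    y ^ 2 * (L - y) ≤ 4 / 27 * L ^ 3 := by
  have : 0 ≤ (2 * L - 3 * y) ^ 2 * (L + 3 * y) := by positivity
  linarith [show (2 * L - 3 * y) ^ 2 * (L + 3 * y) = 4 * L ^ 3 - 27 * (y ^ 2 * (L - y)) by ring]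

/-- The binomial coefficient is r²/2 + r/2. The square part is bounded by `sq_mul_sub_le` at y = r
log 2, and the linear part is at most half of n log N. -/
theorem log_pow_choose_two_le {N n r κ : ℕ} (hr : r ≤ n) (hκ : 0 < κ)
    (h : κ * 2 ^ r ≤ N) :
    Real.log ((κ : ℝ) ^ (r + 1).choose 2) ≤
      2 / 27 * Real.log N ^ 3 / Real.log 2 ^ 2 + n * Real.log N / 2 := by
  set L := Real.log N
  set l := Real.log 2
  have hl : 0 < l := Real.log_pos one_lt_two
  have hL : 0 ≤ L := Real.log_natCast_nonneg N
  have hκ' : (0 : ℝ) < κ := by exact_mod_cast hκ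
  have hκL : Real.log κ ≤ L - r * l := by
    have h1 : Real.log ((κ : ℝ) * 2 ^ r) ≤ L :=
      Real.log_le_log (by positivity) (by exact_mod_cast h)
    rw [Real.log_mul hκ'.ne' (by positivity), Real.log_pow] at h1
    linarith
  have hκ0 : 0 ≤ L - r * l := (Real.log_natCast_nonneg κ).trans hκL
  rw [Real.log_pow, Nat.cast_choose_two]
  push_cast
  have h1 : ((r : ℝ) + 1) * (r + 1 - 1) / 2 * Real.log κ ≤
      ((r : ℝ) + 1) * (r + 1 - 1) / 2 * (L - r * l) := by
    refine mul_le_mul_of_nonneg_left hκL ?_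
    rw [add_sub_cancel_right]
    positivity
  refine h1.trans ?_
  have h2 : (r : ℝ) ^ 2 * (L - r * l) / 2 ≤ 2 / 27 * L ^ 3 / l ^ 2 := by
    rw [le_div_iff₀ (by positivity)]
    have := sq_mul_sub_le hL (by positivity : 0 ≤ r * l)
    nlinarith
  have h3 : (r : ℝ) * (L - r * l) ≤ n * L := by
    have h4 : (r : ℝ) ≤ n := by exact_mod_cast hr
    have h5 : L - r * l ≤ L := sub_le_self _ (by positivity)
    exact mul_le_mul h4 h5 hκ0 (by positivity)
  linarith [show ((r : ℝ) + 1) * (r + 1 - 1) / 2 * (L - r * l) =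
    (r : ℝ) ^ 2 * (L - r * l) / 2 + (r : ℝ) * (L - r * l) / 2 by ring]

theorem log_numCommRings_le_of_le_pow_three {N n h : ℕ} (hN : 2 ≤ N) (hn : N < 2 ^ (n + 1))
    (hn0 : 0 < n) (hh : n ≤ h ^ 3) :
    Real.log (numCommRings N) ≤
      2 / 27 * Real.log N ^ 3 / Real.log 2 ^ 2 + 16 * (h ^ 2 * n * Real.log N) := by
  set L := Real.log N
  have hL : 1 / 2 ≤ L := by
    have h1 : Real.log 2 ≤ L := Real.log_le_log (by norm_num) (by exact_mod_cast hN)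
    linarith [Real.log_two_gt_d9]
  set M := 2 / 27 * L ^ 3 / Real.log 2 ^ 2 + n * L / 2 with hM
  have hM0 : 0 ≤ M := by positivity
  have hh0 : 0 < h := Nat.pos_of_ne_zero (by rintro rfl; omega)
  -- Since h < 2^h, the hypothesis n ≤ h³ allows 3h bits for labelling the maximal ideals; this
  -- keeps `t` of order h².
  have hb : n ≤ 2 ^ (3 * h) := by
    rw [mul_comm, pow_mul]
    exact hh.trans (Nat.pow_le_pow_left Nat.lt_two_pow_self.le 3)
  obtain ⟨-, h1⟩ := finite_quotient_and_numCommRings_le hn hb hh0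
    (le_refl (n / h + (h ^ 2 + 1) + (3 * h + 1)))
  set t := n / h + (h ^ 2 + 1) + (3 * h + 1)
  have ht : t ≤ 7 * h ^ 2 := by
    have h2 : n / h ≤ h ^ 2 := Nat.div_le_of_le_mul (hh.trans_eq (by ring))
    have h3 : h ≤ h ^ 2 := Nat.le_self_pow two_ne_zero h
    have h4 : 1 ≤ h ^ 2 := Nat.one_le_pow _ _ hh0
    omega
  have h2 := h1.trans (CommRingCode.card_le (t := t) (B := ⌊Real.exp M⌋₊) (by omega) hn
    fun r κ hr hκ hle => Nat.le_floor (by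
      push_cast
      rw [← Real.log_le_iff_le_exp (by positivity)]
      exact log_pow_choose_two_le hr hκ hle))
  have hB : (0 : ℝ) < (⌊Real.exp M⌋₊ : ℝ) := by
    exact_mod_cast Nat.floor_pos.2 (Real.one_le_exp hM0)
  have hBM : Real.log (⌊Real.exp M⌋₊ : ℝ) ≤ M :=
    (Real.log_le_log hB (Nat.floor_le (Real.exp_pos M).le)).trans_eq (Real.log_exp M)
  have hN0 : (0 : ℝ) < N := by exact_mod_cast (by omega : 0 < N)
  have hpos : (0 : ℝ) < numCommRings N := by exact_mod_cast numCommRings_pos (by omega)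
  have h3 := Real.log_le_log hpos (Nat.cast_le.2 h2)
  push_cast at h3
  rw [Real.log_mul (by positivity) (by positivity), Real.log_mul (by positivity) (by positivity),
    Real.log_mul (by positivity) (by positivity), Real.log_mul (by positivity) (by positivity),
    Real.log_mul (by positivity) (by positivity), Real.log_mul (by positivity) (by positivity),
    Real.log_mul (by positivity) (by positivity), Real.log_pow, Real.log_pow, Real.log_pow] at h3
  have hlogn : Real.log ((n : ℝ) + 1) ≤ n := by
    linarith [Real.log_le_sub_one_of_pos (by positivity : (0 : ℝ) < n + 1)]
  have hn1 : (1 : ℝ) ≤ n := by exact_mod_cast hn0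
  have hh1 : (1 : ℝ) ≤ (h : ℝ) ^ 2 := one_le_pow₀ (by exact_mod_cast hh0)
  have ht' : (t : ℝ) ≤ 7 * (h : ℝ) ^ 2 := by exact_mod_cast ht
  have hnL : 0 ≤ n * L := by positivity
  have e1 : (n : ℝ) ≤ 2 * (n * L) := by nlinarith
  have e2 : L ≤ n * L := by nlinarith
  have e3 : n * L ≤ (h : ℝ) ^ 2 * n * L := by nlinarith
  have e4 : (t : ℝ) * (n * L) ≤ 7 * ((h : ℝ) ^ 2 * n * L) := by nlinarith
  linarith

theorem log_numCommRings_le {N : ℕ} (hN : 2 ≤ N) :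
    Real.log (numCommRings N) ≤
      2 / 27 * Real.log N ^ 3 / Real.log 2 ^ 2 + 512 * Real.log N ^ (8 / 3 : ℝ) := by
  set L := Real.log N
  have hl := Real.log_two_gt_d9
  have hL : 1 / 2 ≤ L := by
    have h1 : Real.log 2 ≤ L := Real.log_le_log (by norm_num) (by exact_mod_cast hN)
    linarith
  set n := Nat.log 2 N
  have hnL : (n : ℝ) ≤ 2 * L := by
    have := Nat.log_two_mul_log_le (show N ≠ 0 by omega)
    nlinarith [(Nat.cast_nonneg n : (0 : ℝ) ≤ n)]
  set c : ℝ := L ^ (1 / 3 : ℝ)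
  have hc0 : 0 ≤ c := by positivity
  have hc3 : c ^ 3 = L := by
    rw [← Real.rpow_natCast, ← Real.rpow_mul (by linarith)]
    norm_num
  have hc8 : L ^ (8 / 3 : ℝ) = c ^ 8 := by
    rw [← Real.rpow_natCast, ← Real.rpow_mul (by linarith)]
    norm_num
  have hc : 1 / 2 ≤ c := by
    by_contra! hlt
    have : c ^ 3 < (1 / 2) ^ 3 := pow_lt_pow_left₀ hlt hc0 (by norm_num)
    linarith
  have hceil := Nat.le_ceil (2 * c)
  have hceil' := Nat.ceil_lt_add_one (by positivity : 0 ≤ 2 * c)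
  -- The parameter h is 2c rounded up: (2c)³ = 8L exceeds n ≤ 2L, while c ≥ 1/2 gives h ≤ 4c. The
  -- constant 512 is then 16 · 32.
  have hh : n ≤ ⌈2 * c⌉₊ ^ 3 := by
    have h1 : (2 * c) ^ 3 ≤ (⌈2 * c⌉₊ : ℝ) ^ 3 := pow_le_pow_left₀ (by positivity) hceil 3
    have h2 : (n : ℝ) ≤ (⌈2 * c⌉₊ : ℝ) ^ 3 := by nlinarith
    exact_mod_cast h2
  refine (log_numCommRings_le_of_le_pow_three hN (Nat.lt_pow_succ_log_self one_lt_two N)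
    (Nat.log_pos one_lt_two hN) hh).trans ?_
  have h1 : (⌈2 * c⌉₊ : ℝ) ^ 2 ≤ (4 * c) ^ 2 :=
    pow_le_pow_left₀ (by positivity) (by linarith) 2
  have h2 : (⌈2 * c⌉₊ : ℝ) ^ 2 * n * L ≤ (4 * c) ^ 2 * (2 * L) * L := by gcongr
  have h3 : (4 * c) ^ 2 * (2 * L) * L = 32 * c ^ 8 := by
    rw [← hc3]
    ring
  rw [hc8]
  linarith

theorem le_log_numCommRings {N : ℕ} (hN : 8 ≤ N) :
    2 / 27 * Real.log N ^ 3 / Real.log 2 ^ 2 - 512 * Real.log N ^ (8 / 3 : ℝ) ≤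
      Real.log (numCommRings N) := by
  have := finite_quotient_finCommRingSetoid N
  set L := Real.log N
  set l := Real.log 2
  have hl : 1 / 2 < l := by linarith [Real.log_two_gt_d9]
  have hl' : l < 1 := by linarith [Real.log_two_lt_d9]
  set n := Nat.log 2 N
  have hn3 : 3 ≤ n := Nat.le_log_of_pow_le one_lt_two hN
  have hnL : (n : ℝ) * l ≤ L := Nat.log_two_mul_log_le (show N ≠ 0 by omega)
  -- Taking dim V = 2(k + 1) and dim U = k approximates the optimal ratio 2 : 1 and leaves one
  -- dimension for the scalars, for a total of 3(k + 1) ≤ n.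
  obtain ⟨k, hk⟩ : ∃ k, n / 3 = k + 1 := ⟨n / 3 - 1, by omega⟩
  have hkn : 3 * (k + 1) ≤ n := by omega
  have hnk : n + 1 ≤ 3 * (k + 2) := by omega
  have hpow : 2 ^ (1 + 2 * (k + 1) + k) ≤ N :=
    (Nat.pow_le_pow_right two_pos (by omega)).trans (Nat.pow_log_le_self 2 (by omega))
  have h1 := two_pow_le_numCommRings_mul hpow
  have hpos : (0 : ℝ) < numCommRings N := by exact_mod_cast numCommRings_pos (by omega)
  have h2 : Real.log ((2 : ℝ) ^ (k * (2 * (k + 1) + 1).choose 2)) ≤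
      Real.log (numCommRings N * (2 : ℝ) ^ (1 + 2 * (k + 1) + k) ^ 2) :=
    Real.log_le_log (by positivity) (by exact_mod_cast h1)
  rw [Real.log_mul hpos.ne' (by positivity), Real.log_pow, Real.log_pow, Nat.cast_mul,
    Nat.cast_choose_two] at h2
  push_cast at h2
  have hk0 : (0 : ℝ) ≤ k := Nat.cast_nonneg k
  have hL : 1 ≤ L := by
    have : (3 : ℝ) ≤ n := by exact_mod_cast hn3
    nlinarith
  have hLk : L ≤ 3 * (k + 2) * l := by
    have h3 : L ≤ Real.log ((2 : ℝ) ^ (n + 1)) := Real.log_le_log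
      (by exact_mod_cast (by omega : 0 < N))
      (by exact_mod_cast (Nat.lt_pow_succ_log_self one_lt_two N).le)
    rw [Real.log_pow] at h3
    have h4 : ((n + 1 : ℕ) : ℝ) ≤ 3 * (k + 2) := by exact_mod_cast hnk
    nlinarith
  have hmain : 2 / 27 * L ^ 3 / l ^ 2 ≤ 2 * (k + 2) ^ 3 * l := by
    rw [div_le_iff₀ (by positivity)]
    have := pow_le_pow_left₀ (by positivity) hLk 3
    linarith [show 2 * ((k : ℝ) + 2) ^ 3 * l * l ^ 2 = 2 / 27 * (3 * (k + 2) * l) ^ 3 by ring]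
  have hkL : (k : ℝ) + 1 ≤ L := by
    have : (3 : ℝ) * (k + 1) ≤ n := by exact_mod_cast hkn
    nlinarith
  have hL2 : L ^ 2 ≤ L ^ (8 / 3 : ℝ) := by
    rw [← Real.rpow_natCast]
    exact Real.rpow_le_rpow_of_exponent_le hL (by norm_num)
  have hk2 : ((k : ℝ) + 1) ^ 2 ≤ L ^ 2 := pow_le_pow_left₀ (by positivity) hkL 2
  -- The cubic terms in k cancel, so rounding and the count of endomorphisms cost only O(L²), which
  -- is below L^(8/3).
  have hdiff : 2 * ((k : ℝ) + 2) ^ 3 * l -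
      (k * ((2 * (k + 1) + 1) * (2 * (k + 1) + 1 - 1) / 2) * l -
        (1 + 2 * (k + 1) + k) ^ 2 * l) ≤ 25 * (k + 1) ^ 2 * l := by
    have : 2 * ((k : ℝ) + 2) ^ 3 - (k * ((2 * (k + 1) + 1) * (2 * (k + 1) + 1 - 1) / 2) -
        (1 + 2 * (k + 1) + k) ^ 2) ≤ 25 * (k + 1) ^ 2 := by nlinarith
    nlinarith
  have hfin : 25 * ((k : ℝ) + 1) ^ 2 * l ≤ 25 * L ^ 2 := by nlinarith [sq_nonneg L]
  have hL20 : 0 ≤ L ^ 2 := sq_nonneg L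
  linarith

theorem mainTheorem10 :
    ∃ E : ℕ → ℝ,
      E =O[Filter.atTop] (fun N : ℕ => Real.log (N : ℝ) ^ (8 / 3 : ℝ)) ∧
      ∀ N : ℕ, 1 ≤ N →
        (numCommRings N : ℝ) =
          Real.exp (2 / 27 * Real.log (N : ℝ) ^ 3 / Real.log 2 ^ 2 + E N) := by
  refine ⟨fun N => Real.log (numCommRings N) - 2 / 27 * Real.log N ^ 3 / Real.log 2 ^ 2, ?_, ?_⟩
  · refine Asymptotics.IsBigO.of_bound 512 ?_
    filter_upwards [Filter.eventually_ge_atTop 8] with N hN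
    have h1 := log_numCommRings_le (show 2 ≤ N by omega)
    have h2 := le_log_numCommRings hN
    have h3 : 0 ≤ Real.log N ^ (8 / 3 : ℝ) := Real.rpow_nonneg (Real.log_natCast_nonneg N) _
    rw [Real.norm_eq_abs, Real.norm_of_nonneg h3, abs_le]
    constructor <;> linarith
  · intro N hN
    rw [add_sub_cancel, Real.exp_log (by exact_mod_cast numCommRings_pos hN)]
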